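/- Let $G$ be a (real, finite-dimensional) Lie group with Lie algebra $\mathfrak g$, and let $\|\cdot\|$ be a norm on $\mathfrak g$ with energy $\mathrm E(v)=\tfrac12\|v\|^2$; thus $(G,\mathfrak g,\|\cdot\|)$ is a Finsler Lie group. Assume that the norm is strongly convex: there is a Euclidean norm $N$ on $\mathfrak g$ such that $$\mathrm E(tv+(1-t)u)\le t\,\mathrm E(v)+(1-t)\,\mathrm E(u)-t(1-t)N(u-v)^2\qquad\text{for all }u,v\in\mathfrak g,\ t\in[0,1].$$ For an interval $I\subseteq\mathbb R$, a (locally) absolutely continuous curve $\gamma:I\to G$ has control $u(t)=(\mathrm dL_{\gamma(t)})^{-1}\dot\gamma(t)\in\mathfrak g$, defined for a.e. $t\in I$. The curve $\gamma$ is called a normal curve if its control is square-integrable on every compact subinterval of $I$ and there is $\lambda\in\mathfrak g^*$ such that $$\lambda\circ\mathrm{Ad}_{\gamma(t)}\in\partial_{u(t)}\mathrm E\quad\text{for a.e. }t\in I,$$ where $\partial_u\mathrm E=\{\eta\in\mathfrak g^*:\eta(v-u)\le \mathrm E(v)-\mathrm E(u)\ \text{for all }v\in\mathfrak g\}$ is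 the subdifferential. Then every normal curve $\gamma:[0,1]\to G$ is differentiable at every $t\in[0,1]$ (one-sidedly at the endpoints), and the following holds. 1. Let $\gamma_1,\gamma_2:[0,1]\to G$ be normal curves. If there is $t\in[0,1]$ such that $\gamma_1(t)=\gamma_2(t)$, $\dot\gamma_1(t)=\dot\gamma_2(t)$, and $\|\cdot\|$ is differentiable at $(\mathrm dL_{\gamma_1(t)})^{-1}\dot\gamma_1(t)$, then $\gamma_1=\gamma_2$. 2. If moreover $\|\cdot\|$ is differentiable at every $v\in\mathfrak g\setminus\{0\}$, then there is no branching of normal curves in $G$: if $I\subseteq\mathbb R$ is an interval, $\gamma_1,\gamma_2:I\to G$ are normal curves, and $\gamma_1=\gamma_2$ on some nondegenerate interval $J\subseteq I$, then $\gamma_1=\gamma_2$ on $I$. -/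

import Mathlib

open Set MeasureTheory
open scoped Manifold ContDiff

noncomputable section

/-- `N` is a Euclidean norm, i.e. the norm induced by a scalar product. -/
def IsEuclideanNorm {V : Type*} [AddCommGroup V] [Module ℝ V] (N : V → ℝ) : Prop :=
  ∃ B : LinearMap.BilinForm ℝ V,
    (∀ v w, B v w = B w v) ∧ (∀ v, v ≠ 0 → 0 < B v v) ∧ ∀ v, N v = √(B v v)

/-- Strong convexity of a function on a real vector space. -/
def IsStronglyConvexFun {V : Type*} [AddCommGroup V] [Module ℝ V] (f : V → ℝ) : Prop :=
  ∃ N : V → ℝ, IsEuclideanNorm N ∧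
    ∀ u v : V, ∀ t ∈ Icc (0 : ℝ) 1,
      f (t • v + (1 - t) • u) ≤ t * f v + (1 - t) * f u - t * (1 - t) * N (u - v) ^ 2

/-- The energy `v ↦ ‖v‖² / 2` of a norm `p`. -/
def normEnergy {V : Type*} [AddCommGroup V] [Module ℝ V] (p : Seminorm ℝ V) (v : V) : ℝ :=
  p v ^ 2 / 2

/-- A norm is strongly convex when its energy is a strongly convex function. -/
def IsStronglyConvexNorm {V : Type*} [AddCommGroup V] [Module ℝ V] (p : Seminorm ℝ V) : Prop :=
  IsStronglyConvexFun (normEnergy p)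

/-- The subdifferential of `f` at `u`. -/
def subdifferential {V : Type*} [AddCommGroup V] [Module ℝ V] [TopologicalSpace V]
    (f : V → ℝ) (u : V) : Set (V →L[ℝ] ℝ) :=
  {η | ∀ v, η (v - u) ≤ f v - f u}

section LieGroup

variable {E : Type*} [NormedAddCommGroup E] [NormedSpace ℝ E]
  {G : Type*} [TopologicalSpace G] [ChartedSpace E G] [Group G]

/-- The adjoint map `Ad_g : 𝔤 → 𝔤`, the differential at the identity of `x ↦ g x g⁻¹`. -/
def adjointMap (E : Type*) [NormedAddCommGroup E] [NormedSpace ℝ E] {G : Type*}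
    [TopologicalSpace G] [ChartedSpace E G] [Group G] (g : G) :
    GroupLieAlgebra 𝓘(ℝ, E) G →L[ℝ] GroupLieAlgebra 𝓘(ℝ, E) G :=
  mfderiv 𝓘(ℝ, E) 𝓘(ℝ, E) (fun x : G => g * x * g⁻¹) 1

/-- The velocity at time `t` of a curve defined on the interval `I` (one-sided at the endpoints
of `I`). Curves `I → G` are represented by functions on `ℝ` whose values outside `I` are
irrelevant. -/
def velocity (E : Type*) [NormedAddCommGroup E] [NormedSpace ℝ E] {G : Type*}
    [TopologicalSpace G] [ChartedSpace E G] (I : Set ℝ) (γ : ℝ → G) (t : ℝ) :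
    TangentSpace 𝓘(ℝ, E) (γ t) :=
  mfderivWithin 𝓘(ℝ, ℝ) 𝓘(ℝ, E) γ I t (1 : ℝ)

/-- The control `u(t) = (dL_{γ(t)})⁻¹ γ'(t) ∈ 𝔤` of a curve `γ : I → G`; the inverse of
`dL_{γ(t)}` is the differential of `L_{γ(t)⁻¹}` at `γ(t)`. -/
def curveControl (E : Type*) [NormedAddCommGroup E] [NormedSpace ℝ E] {G : Type*}
    [TopologicalSpace G] [ChartedSpace E G] [Group G] (I : Set ℝ) (γ : ℝ → G) (t : ℝ) :
    GroupLieAlgebra 𝓘(ℝ, E) G :=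
  mfderiv 𝓘(ℝ, E) 𝓘(ℝ, E) (fun x : G => (γ t)⁻¹ * x) (γ t) (velocity E I γ t)

/-- Absolute continuity of a curve `γ : I → G` with values in a manifold: `γ` is continuous, and it
is absolutely continuous in charts on every compact subinterval that it maps into a chart domain. -/
def IsAbsolutelyContinuousCurve (E : Type*) [NormedAddCommGroup E] [NormedSpace ℝ E] {G : Type*}
    [TopologicalSpace G] [ChartedSpace E G] (I : Set ℝ) (γ : ℝ → G) : Prop :=
  ContinuousOn γ I ∧
    ∀ (x : G) (a b : ℝ), a ≤ b → Icc a b ⊆ I → MapsTo γ (Icc a b) (chartAt E x).source →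
      AbsolutelyContinuousOnInterval (fun t => chartAt E x (γ t)) a b

/-- Normal curves `γ : I → G` in the Finsler Lie group `(G, 𝔤, p)`. As the polarization is all of
`𝔤`, every absolutely continuous curve is horizontal. The control is in `L²` on compact
subintervals of `I`, and for some covector `lam` the normal inclusion
`lam ∘ Ad_{γ(t)} ∈ ∂_{u(t)} E` holds for almost every `t ∈ I`. -/
def IsNormalCurve (p : Seminorm ℝ (GroupLieAlgebra 𝓘(ℝ, E) G)) (I : Set ℝ) (γ : ℝ → G) : Prop :=
  IsAbsolutelyContinuousCurve E I γ ∧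
    (∀ a b : ℝ, Icc a b ⊆ I → IntegrableOn (fun t => p (curveControl E I γ t) ^ 2) (Icc a b)) ∧
    ∃ lam : GroupLieAlgebra 𝓘(ℝ, E) G →L[ℝ] ℝ,
      ∀ᵐ t ∂(volume.restrict I),
        lam.comp (adjointMap E (γ t)) ∈ subdifferential (normEnergy p) (curveControl E I γ t)

/-- There is branching of normal curves: two different normal curves `I → G` on an interval `I`
coincide on some nondegenerate interval `J ⊆ I`. -/
def HasBranchingOfNormalCurves (p : Seminorm ℝ (GroupLieAlgebra 𝓘(ℝ, E) G)) : Prop :=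
  ∃ (I J : Set ℝ) (γ₁ γ₂ : ℝ → G), I.OrdConnected ∧ J.OrdConnected ∧ J.Nontrivial ∧ J ⊆ I ∧
    IsNormalCurve p I γ₁ ∧ IsNormalCurve p I γ₂ ∧ EqOn γ₁ γ₂ J ∧ ¬ EqOn γ₁ γ₂ I

end LieGroup

end

/-! ### Convex analysis: inverting the subdifferential of the energy. -/

section Subdifferential

variable {V : Type*} [NormedAddCommGroup V] [NormedSpace ℝ V]

/-! Strong convexity makes the subdifferential of the energy strongly monotone, so its inverse is a
single-valued Lipschitz map `Φ` from covectors to vectors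
(`exists_lipschitzWith_inverse_subdifferential`). The normal inclusion then reads `u = Φ (lam ∘
Ad_γ)` almost everywhere: a normal curve solves an ODE whose right-hand side is locally Lipschitz,
since left translation and `Ad` are smooth. An absolutely continuous solution of such an ODE is
differentiable at every time and satisfies the equation there, and two solutions with the same
covector that meet coincide (`eqOn_of_ae_control_eq`).

It remains to recover the covector. Where the energy is differentiable its only subgradient is its
derivative, so the control at one time determines `lam ∘ Ad_γ`, hence `lam`, because `Ad` is
invertible. This is part 1. For part 2, take a time interior to `J`: position and control agree
there, and the energy is differentiable at that control, even if it vanishes, because the energy is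
quadratically small at `0`. -/

theorem exists_pos_mul_sq_norm_le [FiniteDimensional ℝ V] {q : V → ℝ} (hq : Continuous q)
    (hom : ∀ (r : ℝ) v, q (r • v) = r ^ 2 * q v) (pos : ∀ v, v ≠ 0 → 0 < q v) :
    ∃ c > 0, ∀ v, c * ‖v‖ ^ 2 ≤ q v := by
  have h0 : q 0 = 0 := by simpa using hom 0 0
  rcases subsingleton_or_nontrivial V with _ | _
  · exact ⟨1, one_pos, fun v => by simp [Subsingleton.elim v 0, h0]⟩
  obtain ⟨x, hx, hmin⟩ := (isCompact_sphere (0 : V) 1).exists_isMinOn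
    (NormedSpace.sphere_nonempty.2 zero_le_one) hq.continuousOn
  have hx0 : x ≠ 0 := by
    rintro rfl
    simp at hx
  refine ⟨q x, pos x hx0, fun v => ?_⟩
  rcases eq_or_ne v 0 with rfl | hv
  · simp [h0]
  have hv' : ‖v‖ ≠ 0 := norm_ne_zero_iff.2 hv
  have hmem : ‖v‖⁻¹ • v ∈ Metric.sphere (0 : V) 1 := by
    simp [norm_smul, hv']
  have h1 : q x ≤ q (‖v‖⁻¹ • v) := hmin hmem
  have h2 : q v = ‖v‖ ^ 2 * q (‖v‖⁻¹ • v) := by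
    rw [← hom, smul_smul, mul_inv_cancel₀ hv', one_smul]
  rw [h2, mul_comm]
  gcongr

theorem Seminorm.continuous_of_finiteDimensional [FiniteDimensional ℝ V] (p : Seminorm ℝ V) :
    Continuous p :=
  continuousOn_univ.1 (p.convexOn.continuousOn isOpen_univ)

theorem continuous_normEnergy [FiniteDimensional ℝ V] (p : Seminorm ℝ V) :
    Continuous (normEnergy p) :=
  (p.continuous_of_finiteDimensional.pow 2).div_const 2

theorem normEnergy_smul (p : Seminorm ℝ V) (r : ℝ) (v : V) :
    normEnergy p (r • v) = r ^ 2 * normEnergy p v := by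
  simp only [normEnergy, map_smul_eq_mul, mul_pow, Real.norm_eq_abs, sq_abs]
  ring

/-- A covector `η` is a subgradient at `u` exactly when `u` minimises the energy minus `η`. A
minimiser exists because the quadratic growth of the energy dominates the linear term. -/
theorem exists_mem_subdifferential_normEnergy [FiniteDimensional ℝ V] {p : Seminorm ℝ V}
    (hp : ∀ v, p v = 0 → v = 0) (η : V →L[ℝ] ℝ) : ∃ u, η ∈ subdifferential (normEnergy p) u := by
  obtain ⟨c, hc, hcq⟩ := exists_pos_mul_sq_norm_le (continuous_normEnergy p) (normEnergy_smul p)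
    (fun v hv => by
      have : 0 < p v := lt_of_le_of_ne (apply_nonneg p v) fun h => hv (hp v h.symm)
      unfold normEnergy
      positivity)
  have hlim : Filter.Tendsto (fun v => normEnergy p v - η v) (Filter.cocompact V) Filter.atTop := by
    have h1 : Filter.Tendsto (fun r : ℝ => r * (c * r - ‖η‖)) Filter.atTop Filter.atTop :=
      Filter.tendsto_id.atTop_mul_atTop₀
        (Filter.tendsto_atTop_add_const_right _ _ (Filter.tendsto_id.const_mul_atTop hc))
    refine Filter.tendsto_atTop_mono (fun v => ?_) (h1.comp (tendsto_norm_cocompact_atTop (E := V)))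
    have h2 : η v ≤ ‖η‖ * ‖v‖ := (le_abs_self _).trans (η.le_opNorm v)
    have h3 := hcq v
    simp only [Function.comp_apply]
    nlinarith
  obtain ⟨u, hu⟩ := ((continuous_normEnergy p).sub η.continuous).exists_forall_le hlim
  refine ⟨u, fun v => ?_⟩
  have := hu v
  simp only [Pi.sub_apply] at this
  rw [map_sub]
  linarith

/-- Test the subgradient inequality at the midpoint of `u` and `v`, bound the value there by strong
convexity, and double. The resulting factor `1 / 2` is not optimal but suffices. -/
theorem subdifferential_add_sq_le {f N : V → ℝ}
    (hf : ∀ u v : V, ∀ t ∈ Icc (0 : ℝ) 1,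
      f (t • v + (1 - t) • u) ≤ t * f v + (1 - t) * f u - t * (1 - t) * N (u - v) ^ 2)
    {η : V →L[ℝ] ℝ} {u : V} (hη : η ∈ subdifferential f u) (v : V) :
    η (v - u) + N (u - v) ^ 2 / 2 ≤ f v - f u := by
  have h1 := hf u v (1 / 2) ⟨by norm_num, by norm_num⟩
  have h2 := hη ((1 / 2 : ℝ) • v + (1 - 1 / 2 : ℝ) • u)
  have h3 : (1 / 2 : ℝ) • v + (1 - 1 / 2 : ℝ) • u - u = (1 / 2 : ℝ) • (v - u) := by
    module
  rw [h3, map_smul, smul_eq_mul] at h2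
  linarith

/-- Adding the improved subgradient inequalities at `u` and `v` cancels the values of `f` and leaves
`N (u - v) ^ 2 ≤ (η - ξ) (u - v)`. Comparing `N` with the ambient norm and dividing by `‖u - v‖`
gives the bound. -/
theorem exists_mul_norm_sub_le_of_isStronglyConvexFun [FiniteDimensional ℝ V] {f : V → ℝ}
    (hf : IsStronglyConvexFun f) : ∃ c > 0, ∀ u v (η ξ : V →L[ℝ] ℝ), η ∈ subdifferential f u →
      ξ ∈ subdifferential f v → c * ‖u - v‖ ≤ ‖η - ξ‖ := by
  obtain ⟨N, ⟨B, -, Bpos, hN⟩, hf⟩ := hf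
  have hNsq : ∀ v, N v ^ 2 = B v v := fun v => by
    rw [hN, Real.sq_sqrt]
    rcases eq_or_ne v 0 with rfl | hv
    · simp
    · exact (Bpos v hv).le
  have hBc : Continuous fun v => B v v :=
    (LinearMap.toContinuousLinearMap
      ((LinearMap.toContinuousLinearMap : (V →ₗ[ℝ] ℝ) ≃ₗ[ℝ] V →L[ℝ] ℝ).toLinearMap ∘ₗ B)
      ).continuous.clm_apply continuous_id
  obtain ⟨c, hc, hcB⟩ := exists_pos_mul_sq_norm_le hBc
    (fun r v => by simp only [map_smul, LinearMap.smul_apply, smul_eq_mul]; ring) Bpos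
  refine ⟨c, hc, fun u v η ξ hη hξ => ?_⟩
  have h1 := subdifferential_add_sq_le hf hη v
  have h2 := subdifferential_add_sq_le hf hξ u
  have h3 := hcB (u - v)
  have h4 := hcB (v - u)
  rw [hNsq] at h1 h2
  have h5 : (η - ξ) (u - v) ≤ ‖η - ξ‖ * ‖u - v‖ :=
    (le_abs_self _).trans ((η - ξ).le_opNorm _)
  have h6 : η (v - u) = -η (u - v) := by rw [← map_neg, neg_sub]
  rw [norm_sub_rev v u] at h4
  simp only [sub_apply] at h5
  rcases (norm_nonneg (u - v)).eq_or_lt with h0 | h0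
  · rw [← h0, mul_zero]
    exact norm_nonneg _
  · refine le_of_mul_le_mul_right ?_ h0
    nlinarith

/-- The inverse of the subdifferential of a strongly convex energy is a Lipschitz map: it is the
gradient of the dual energy. -/
theorem exists_lipschitzWith_inverse_subdifferential [FiniteDimensional ℝ V] {p : Seminorm ℝ V}
    (hp : ∀ v, p v = 0 → v = 0) (hconv : IsStronglyConvexNorm p) :
    ∃ (Φ : (V →L[ℝ] ℝ) → V) (K : NNReal), LipschitzWith K Φ ∧
      ∀ η u, η ∈ subdifferential (normEnergy p) u ↔ u = Φ η := by
  choose Φ hΦ using exists_mem_subdifferential_normEnergy hp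
  obtain ⟨c, hc, hmono⟩ := exists_mul_norm_sub_le_of_isStronglyConvexFun hconv
  refine ⟨Φ, (Real.toNNReal c⁻¹), LipschitzWith.of_dist_le_mul fun η ξ => ?_, fun η u => ?_⟩
  · rw [Real.coe_toNNReal _ (by positivity), dist_eq_norm, dist_eq_norm, inv_mul_eq_div,
      le_div_iff₀' hc]
    exact hmono _ _ _ _ (hΦ η) (hΦ ξ)
  · refine ⟨fun h => ?_, fun h => h ▸ hΦ η⟩
    have h1 := hmono _ _ _ _ h (hΦ η)
    rw [sub_self, norm_zero] at h1
    have h2 : ‖u - Φ η‖ ≤ 0 := nonpos_of_mul_nonpos_right h1 hc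
    exact sub_eq_zero.1 (norm_le_zero_iff.1 h2)

theorem eq_fderiv_of_mem_subdifferential {f : V → ℝ} {u : V} (hf : DifferentiableAt ℝ f u)
    {η : V →L[ℝ] ℝ} (hη : η ∈ subdifferential f u) : η = fderiv ℝ f u := by
  have hmin : IsLocalMin (fun v => f v - η v) u := Filter.Eventually.of_forall fun v => by
    have := hη v
    rw [map_sub] at this
    simp only
    linarith
  have := hmin.hasFDerivAt_eq_zero (hf.hasFDerivAt.sub η.hasFDerivAt)
  exact (sub_eq_zero.1 this).symm

theorem differentiableAt_normEnergy {p : Seminorm ℝ V} {u : V} (hu : DifferentiableAt ℝ p u) :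
    DifferentiableAt ℝ (normEnergy p) u := by
  have : normEnergy p = fun v => 2⁻¹ * p v ^ 2 := funext fun v => by
    rw [normEnergy]
    ring
  rw [this]
  exact (hu.pow 2).const_mul _

/-- A norm on a nontrivial space is not differentiable at `0`, but its energy is `O(‖v‖²)` there.
This covers vanishing controls in the no-branching statement. -/
theorem differentiableAt_normEnergy_zero [FiniteDimensional ℝ V] (p : Seminorm ℝ V) :
    DifferentiableAt ℝ (normEnergy p) 0 := by
  obtain ⟨C, hC, hpC⟩ := Seminorm.bound_of_continuous_normedSpace p
    p.continuous_of_finiteDimensional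
  have h : normEnergy p =O[nhds 0] fun v : V => ‖v - 0‖ ^ 2 := by
    refine Asymptotics.IsBigO.of_bound (C ^ 2 / 2) (Filter.Eventually.of_forall fun v => ?_)
    have h1 : p v ^ 2 ≤ (C * ‖v‖) ^ 2 := by
      gcongr
      exact hpC v
    have h2 : 0 ≤ p v ^ 2 / 2 := by positivity
    simp only [normEnergy, Real.norm_of_nonneg h2, sub_zero, norm_pow, norm_norm]
    linarith [mul_pow C ‖v‖ 2]
  exact (h.hasFDerivAt one_lt_two).differentiableAt

end Subdifferential

/-! ### From almost everywhere to everywhere for absolutely continuous functions. -/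

section AbsolutelyContinuous

variable {F : Type*} [NormedAddCommGroup F] [NormedSpace ℝ F] [FiniteDimensional ℝ F]

/-- The difference of `f` and a primitive of `g` is absolutely continuous with derivative zero
almost everywhere, hence constant. The hypothesis only constrains derivatives that exist; almost
everywhere existence comes from bounded variation. -/
theorem AbsolutelyContinuousOnInterval.hasDerivWithinAt_of_ae {f g : ℝ → F} {a b : ℝ}
    (hab : a ≤ b) (hf : AbsolutelyContinuousOnInterval f a b) (hg : ContinuousOn g (Icc a b))
    (h : ∀ᵐ t, t ∈ Ioo a b → ∀ v, HasDerivAt f v t → v = g t) :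
    ∀ t ∈ Icc a b, HasDerivWithinAt f (g t) (Icc a b) t := by
  have : CompleteSpace F := FiniteDimensional.complete ℝ F
  -- A continuous extension of `g` to the line makes the primitive differentiable at the endpoints
  -- too.
  set k : ℝ → F := IccExtend hab ((Icc a b).domRestrict g) with hk
  have hkc : Continuous k := hg.domRestrict.Icc_extend'
  have hkg : ∀ t ∈ Icc a b, k t = g t := fun t ht => by
    rw [hk, IccExtend_of_mem _ _ ht, domRestrict_apply]
  set P : ℝ → F := fun t => ∫ s in a..t, k s with hP
  have hPd : ∀ t, HasDerivAt P (k t) t := fun t =>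
    intervalIntegral.integral_hasDerivAt_right (hkc.intervalIntegrable _ _)
      hkc.stronglyMeasurable.stronglyMeasurableAtFilter hkc.continuousAt
  have hPac : AbsolutelyContinuousOnInterval P a b := by
    refine ContDiffOn.absolutelyContinuousOnInterval (ContDiff.contDiffOn ?_)
    rw [contDiff_one_iff_deriv, funext fun t => (hPd t).deriv]
    exact ⟨fun t => (hPd t).differentiableAt, hkc⟩
  obtain ⟨C, hC⟩ := (hf.sub hPac).const_of_ae_hasDerivAt_zero (by
    filter_upwards [h, hf.boundedVariationOn.ae_differentiableAt_of_mem_uIcc,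
      Measure.ae_ne volume a, Measure.ae_ne volume b] with t h1 h2 hta htb ht
    rw [uIcc_of_le hab] at ht
    have ht' : t ∈ Ioo a b := ⟨lt_of_le_of_ne ht.1 (Ne.symm hta), lt_of_le_of_ne ht.2 htb⟩
    have h3 := (h2 (uIcc_of_le hab ▸ ht)).hasDerivAt
    have h4 := h3.sub (hPd t)
    rwa [hkg t ht, h1 ht' _ h3, sub_self] at h4)
  rw [uIcc_of_le hab] at hC
  have hfP : ∀ t ∈ Icc a b, f t = P t + C := fun t ht => by
    rw [← hC t ht, Pi.sub_apply]
    abel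
  intro t ht
  rw [← hkg t ht]
  exact ((hPd t).add_const C).hasDerivWithinAt.congr hfP (hfP t ht)

end AbsolutelyContinuous

/-! ### Intervals and local uniqueness for ODEs. -/

section ODE

theorem OrdConnected.exists_Icc_mem_nhdsWithin {I : Set ℝ} (hI : I.OrdConnected)
    (hI' : I.Nontrivial) {t : ℝ} (ht : t ∈ I) {s : Set ℝ} (hs : s ∈ nhdsWithin t I) :
    ∃ a b, a < b ∧ t ∈ Icc a b ∧ Icc a b ⊆ I ∧ Icc a b ⊆ s ∧ Icc a b ∈ nhdsWithin t I := by
  obtain ⟨ε, hε, hεs⟩ := Metric.mem_nhdsWithin_iff.1 hs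
  -- If `t` is the left end of `I`, then `a = t`; otherwise `a` lies strictly to the left of `t`,
  -- within `ε / 2`. The clause with `c` makes the final interval a neighbourhood within `I`; the
  -- last clause gives `a < b`.
  have hL : ∃ a ∈ I, a ≤ t ∧ t - ε / 2 ≤ a ∧ (∃ c < t, ∀ r ∈ I, c < r → a ≤ r) ∧
      ((∃ r ∈ I, r < t) → a < t) := by
    by_cases h : ∃ r ∈ I, r < t
    · obtain ⟨r, hr, hrt⟩ := h
      have hm : max r (t - ε / 2) < t := max_lt hrt (by linarith)
      exact ⟨max r (t - ε / 2), hI.out hr ht ⟨le_max_left _ _, hm.le⟩, hm.le, le_max_right _ _,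
        ⟨_, hm, fun _ _ h => h.le⟩, fun _ => hm⟩
    · push Not at h
      exact ⟨t, ht, le_rfl, by linarith, ⟨t - 1, by linarith, fun r hr _ => h r hr⟩,
        fun ⟨r, hr, hrt⟩ => absurd (h r hr) (not_le.2 hrt)⟩
  have hR : ∃ b ∈ I, t ≤ b ∧ b ≤ t + ε / 2 ∧ (∃ c > t, ∀ r ∈ I, r < c → r ≤ b) ∧
      ((∃ r ∈ I, t < r) → t < b) := by
    by_cases h : ∃ r ∈ I, t < r
    · obtain ⟨r, hr, hrt⟩ := h
      have hm : t < min r (t + ε / 2) := lt_min hrt (by linarith)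
      exact ⟨min r (t + ε / 2), hI.out ht hr ⟨hm.le, min_le_left _ _⟩, hm.le, min_le_right _ _,
        ⟨_, hm, fun _ _ h => h.le⟩, fun _ => hm⟩
    · push Not at h
      exact ⟨t, ht, le_rfl, by linarith, ⟨t + 1, by linarith, fun r hr _ => h r hr⟩,
        fun ⟨r, hr, hrt⟩ => absurd (h r hr) (not_le.2 hrt)⟩
  obtain ⟨a, ha, hat, haε, ⟨c, hc, hca⟩, ha'⟩ := hL
  obtain ⟨b, hb, hbt, hbε, ⟨d, hd, hdb⟩, hb'⟩ := hR
  have hsub : Icc a b ⊆ I := hI.out ha hb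
  refine ⟨a, b, ?_, ⟨hat, hbt⟩, hsub, fun r hr => hεs ⟨?_, hsub hr⟩, ?_⟩
  · obtain ⟨r, hr, hrt⟩ := hI'.exists_ne t
    rcases lt_or_gt_of_ne hrt with h | h
    · exact (ha' ⟨r, hr, h⟩).trans_le hbt
    · exact hat.trans_lt (hb' ⟨r, hr, h⟩)
  · rw [Metric.mem_ball, Real.dist_eq, abs_lt]
    constructor <;> linarith [hr.1, hr.2]
  · filter_upwards [self_mem_nhdsWithin, mem_nhdsWithin_of_mem_nhds (Ioo_mem_nhds hc hd)]
      with r hr hr'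
    exact ⟨hca r hr hr'.1, hdb r hr hr'.2⟩

/-- Local uniqueness for autonomous ordinary differential equations on an interval, including
its endpoints. -/
theorem eventuallyEq_nhdsWithin_of_hasDerivWithinAt {E : Type*} [NormedAddCommGroup E]
    [NormedSpace ℝ E] {I : Set ℝ} (hI : I.OrdConnected) (hI' : I.Nontrivial) {f g : ℝ → E}
    {X : E → E} {K : NNReal} {s : Set E} (hX : LipschitzOnWith K X s) {t : ℝ} (ht : t ∈ I)
    (hs : s ∈ nhds (f t)) (hf : ∀ᶠ r in nhdsWithin t I, HasDerivWithinAt f (X (f r)) I r)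
    (hg : ∀ᶠ r in nhdsWithin t I, HasDerivWithinAt g (X (g r)) I r) (hfg : f t = g t) :
    f =ᶠ[nhdsWithin t I] g := by
  have hfs : ∀ᶠ r in nhdsWithin t I, f r ∈ s :=
    (hf.self_of_nhdsWithin ht).continuousWithinAt hs
  have hgs : ∀ᶠ r in nhdsWithin t I, g r ∈ s :=
    (hg.self_of_nhdsWithin ht).continuousWithinAt (hfg ▸ hs)
  obtain ⟨a, b, -, htab, hsub, hall, hnhds⟩ := OrdConnected.exists_Icc_mem_nhdsWithin hI hI' ht
    (hf.and (hg.and (hfs.and hgs)))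
  have hfc : ContinuousOn f (Icc a b) := fun r hr => (hall hr).1.continuousWithinAt.mono hsub
  have hgc : ContinuousOn g (Icc a b) := fun r hr => (hall hr).2.1.continuousWithinAt.mono hsub
  have hl : Icc a t ⊆ Icc a b := Icc_subset_Icc_right htab.2
  have hr : Icc t b ⊆ Icc a b := Icc_subset_Icc_left htab.1
  have key : EqOn f g (Icc a b) := by
    -- Uniqueness runs backwards from `t` on the left piece and forwards on the right one; either
    -- piece may be a point.
    rw [← Icc_union_Icc_eq_Icc htab.1 htab.2]
    refine EqOn.union ?_ ?_
    · have hm : ∀ r ∈ Ioc a t, r ∈ Icc a b ∧ I ∈ nhdsWithin r (Iic r) := fun r hr =>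
        ⟨hl (Ioc_subset_Icc_self hr), Filter.mem_of_superset (Icc_mem_nhdsLE hr.1)
          ((Icc_subset_Icc_right hr.2).trans (hl.trans hsub))⟩
      exact ODE_solution_unique_of_mem_Icc_left (v := fun _ => X) (s := fun _ => s)
        (fun _ _ => hX) (hfc.mono hl)
        (fun r hr => (hall (hm r hr).1).1.mono_of_mem_nhdsWithin (hm r hr).2)
        (fun r hr => (hall (hm r hr).1).2.2.1) (hgc.mono hl)
        (fun r hr => (hall (hm r hr).1).2.1.mono_of_mem_nhdsWithin (hm r hr).2)
        (fun r hr => (hall (hm r hr).1).2.2.2) hfg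
    · have hm : ∀ r ∈ Ico t b, r ∈ Icc a b ∧ I ∈ nhdsWithin r (Ici r) := fun r hr' =>
        ⟨hr (Ico_subset_Icc_self hr'), Filter.mem_of_superset (Icc_mem_nhdsGE hr'.2)
          ((Icc_subset_Icc_left hr'.1).trans (hr.trans hsub))⟩
      exact ODE_solution_unique_of_mem_Icc_right (v := fun _ => X) (s := fun _ => s)
        (fun _ _ => hX) (hfc.mono hr)
        (fun r hr => (hall (hm r hr).1).1.mono_of_mem_nhdsWithin (hm r hr).2)
        (fun r hr => (hall (hm r hr).1).2.2.1) (hgc.mono hr)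
        (fun r hr => (hall (hm r hr).1).2.1.mono_of_mem_nhdsWithin (hm r hr).2)
        (fun r hr => (hall (hm r hr).1).2.2.2) hfg
  exact Filter.mem_of_superset hnhds key

end ODE

/-! ### Left translation and the adjoint map in charts. -/

section LieGroupCharts

variable {E : Type*} [NormedAddCommGroup E] [NormedSpace ℝ E]
  {G : Type*} [TopologicalSpace G] [ChartedSpace E G] [Group G]

/-- The adjoint map, as an endomorphism of the model space. -/
noncomputable def adjointModel (E : Type*) [NormedAddCommGroup E] [NormedSpace ℝ E]
    {G : Type*} [TopologicalSpace G] [ChartedSpace E G] [Group G] (g : G) : E →L[ℝ] E :=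
  adjointMap E g

/-- The control of a curve, as a vector of the model space. -/
noncomputable def controlModel (E : Type*) [NormedAddCommGroup E] [NormedSpace ℝ E]
    {G : Type*} [TopologicalSpace G] [ChartedSpace E G] [Group G] (I : Set ℝ) (γ : ℝ → G)
    (t : ℝ) : E :=
  curveControl E I γ t

/-- The differential at the identity of the left translation by the point with coordinate `x`, read
in the charts at `1` and `c`. -/
noncomputable def leftTranslationDeriv (E : Type*) [NormedAddCommGroup E] [NormedSpace ℝ E]
    {G : Type*} [TopologicalSpace G] [ChartedSpace E G] [Group G] (c : G) (x : E) : E →L[ℝ] E :=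
  fderiv ℝ (fun y => chartAt E c ((chartAt E c).symm x * (chartAt E (1 : G)).symm y))
    (chartAt E (1 : G) 1)

variable [LieGroup 𝓘(ℝ, E) ∞ G]

theorem contMDiffAt_chartAt (c : G) {g : G} (hg : g ∈ (chartAt E c).source) :
    ContMDiffAt 𝓘(ℝ, E) 𝓘(ℝ, E) ∞ (chartAt E c) g :=
  contMDiffAt_of_mem_maximalAtlas (IsManifold.chart_mem_maximalAtlas c) hg

theorem contMDiffAt_chartAt_symm (c : G) {x : E} (hx : x ∈ (chartAt E c).target) :
    ContMDiffAt 𝓘(ℝ, E) 𝓘(ℝ, E) ∞ (chartAt E c).symm x :=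
  contMDiffAt_symm_of_mem_maximalAtlas (IsManifold.chart_mem_maximalAtlas c) hx

/-- Order two is what is needed: one derivative in `y` produces `Ad`, which then remains `C¹` in
`x`, hence locally Lipschitz. -/
theorem contDiffAt_chart_conj (c g : G) (hg : g ∈ (chartAt E c).source) :
    ContDiffAt ℝ 2 (Function.uncurry fun x y : E => chartAt E (1 : G)
      ((chartAt E c).symm x * (chartAt E (1 : G)).symm y * ((chartAt E c).symm x)⁻¹))
      (chartAt E c g, chartAt E (1 : G) 1) := by
  refine ContDiffAt.of_le (n := ∞) ?_ (WithTop.coe_le_coe.2 (le_top : (2 : ℕ∞) ≤ ⊤))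
  rw [← contMDiffAt_iff_contDiffAt]
  have h1 : ContMDiffAt 𝓘(ℝ, E × E) 𝓘(ℝ, E) ∞ (fun z : E × E => (chartAt E c).symm z.1)
      (chartAt E c g, chartAt E (1 : G) 1) :=
    (contMDiffAt_chartAt_symm c ((chartAt E c).map_source hg)).comp
      (chartAt E c g, chartAt E (1 : G) 1) contDiff_fst.contMDiff.contMDiffAt
  have h2 : ContMDiffAt 𝓘(ℝ, E × E) 𝓘(ℝ, E) ∞ (fun z : E × E => (chartAt E (1 : G)).symm z.2)
      (chartAt E c g, chartAt E (1 : G) 1) :=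
    (contMDiffAt_chartAt_symm 1 (mem_chart_target E (1 : G))).comp
      (chartAt E c g, chartAt E (1 : G) 1) contDiff_snd.contMDiff.contMDiffAt
  refine ContMDiffAt.comp (chartAt E c g, chartAt E (1 : G) 1)
    (contMDiffAt_chartAt 1 ?_) ((h1.mul h2).mul h1.inv)
  simp [(chartAt E c).left_inv hg]

theorem contDiffAt_chart_mul (c g : G) (hg : g ∈ (chartAt E c).source) :
    ContDiffAt ℝ 2 (Function.uncurry fun x y : E => chartAt E c
      ((chartAt E c).symm x * (chartAt E (1 : G)).symm y))
      (chartAt E c g, chartAt E (1 : G) 1) := by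
  refine ContDiffAt.of_le (n := ∞) ?_ (WithTop.coe_le_coe.2 (le_top : (2 : ℕ∞) ≤ ⊤))
  rw [← contMDiffAt_iff_contDiffAt]
  have h1 : ContMDiffAt 𝓘(ℝ, E × E) 𝓘(ℝ, E) ∞ (fun z : E × E => (chartAt E c).symm z.1)
      (chartAt E c g, chartAt E (1 : G) 1) :=
    (contMDiffAt_chartAt_symm c ((chartAt E c).map_source hg)).comp
      (chartAt E c g, chartAt E (1 : G) 1) contDiff_fst.contMDiff.contMDiffAt
  have h2 : ContMDiffAt 𝓘(ℝ, E × E) 𝓘(ℝ, E) ∞ (fun z : E × E => (chartAt E (1 : G)).symm z.2)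
      (chartAt E c g, chartAt E (1 : G) 1) :=
    (contMDiffAt_chartAt_symm 1 (mem_chart_target E (1 : G))).comp
      (chartAt E c g, chartAt E (1 : G) 1) contDiff_snd.contMDiff.contMDiffAt
  refine ContMDiffAt.comp (chartAt E c g, chartAt E (1 : G) 1)
    (contMDiffAt_chartAt c ?_) (h1.mul h2)
  simpa [(chartAt E c).left_inv hg] using hg

theorem contDiffAt_leftTranslationDeriv {c g : G} (hg : g ∈ (chartAt E c).source) :
    ContDiffAt ℝ 1 (leftTranslationDeriv E c) (chartAt E c g) :=
  ContDiffAt.fderiv (contDiffAt_chart_mul c g hg) contDiffAt_const (by norm_num)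

theorem differentiableAt_chart_conj (g : G) : DifferentiableAt ℝ
    (fun y : E => chartAt E (1 : G) (g * (chartAt E (1 : G)).symm y * g⁻¹))
    (chartAt E (1 : G) 1) := by
  have h := (contDiffAt_chart_conj (E := E) g g (mem_chart_source E g)).differentiableAt two_ne_zero
  have h2 := h.comp (chartAt E (1 : G) 1)
    ((differentiableAt_const (chartAt E g g)).prodMk differentiableAt_id)
  simpa [Function.comp_def, (chartAt E g).left_inv (mem_chart_source E g)] using h2

theorem differentiableAt_chart_mul {c g : G} (hg : g ∈ (chartAt E c).source) : DifferentiableAt ℝ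
    (fun y : E => chartAt E c ((chartAt E c).symm (chartAt E c g) * (chartAt E (1 : G)).symm y))
    (chartAt E (1 : G) 1) := by
  have h := (contDiffAt_chart_mul (E := E) c g hg).differentiableAt two_ne_zero
  exact h.comp (chartAt E (1 : G) 1)
    ((differentiableAt_const (chartAt E c g)).prodMk differentiableAt_id)

theorem adjointModel_eq_fderiv (g : G) : adjointModel E g =
    fderiv ℝ (fun y => chartAt E (1 : G) (g * (chartAt E (1 : G)).symm y * g⁻¹))
      (chartAt E (1 : G) 1) := by
  have hd : MDifferentiableAt 𝓘(ℝ, E) 𝓘(ℝ, E) (fun x : G => g * x * g⁻¹) 1 :=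
    ContMDiffAt.mdifferentiableAt (n := ∞)
      ((contMDiffAt_const.mul contMDiffAt_id).mul contMDiffAt_const) (by simp)
  have h1 : g * 1 * g⁻¹ = 1 := by simp
  unfold adjointModel adjointMap
  rw [hd.mfderiv]
  simp only [writtenInExtChartAt, h1]
  simp [Function.comp_def]

theorem contDiffAt_adjointModel {c g : G} (hg : g ∈ (chartAt E c).source) :
    ContDiffAt ℝ 1 (fun x : E => adjointModel E ((chartAt E c).symm x))
      (chartAt E c g) := by
  have h : (fun x : E => adjointModel E ((chartAt E c).symm x)) = fun x =>
      fderiv ℝ (fun y => chartAt E (1 : G) ((chartAt E c).symm x * (chartAt E (1 : G)).symm y *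
        ((chartAt E c).symm x)⁻¹)) (chartAt E (1 : G) 1) :=
    funext fun x => adjointModel_eq_fderiv _
  rw [h]
  exact ContDiffAt.fderiv (contDiffAt_chart_conj c g hg) contDiffAt_const (by norm_num)

/-- Chain rule at the identity: conjugations by `g⁻¹` and `g` compose to the identity. -/
theorem adjointModel_apply_adjointModel_inv (g : G) (v : E) :
    adjointModel E g (adjointModel E g⁻¹ v) = v := by
  have h1 : ∀ h : G, HasFDerivAt
      (fun y : E => chartAt E (1 : G) (h * (chartAt E (1 : G)).symm y * h⁻¹))
      (adjointModel E h) (chartAt E (1 : G) 1) := fun h => by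
    rw [adjointModel_eq_fderiv]
    exact (differentiableAt_chart_conj h).hasFDerivAt
  have h2 : chartAt E (1 : G) (g⁻¹ * (chartAt E (1 : G)).symm (chartAt E (1 : G) 1) * g⁻¹⁻¹) =
      chartAt E (1 : G) 1 := by
    simp [(chartAt E (1 : G)).left_inv (mem_chart_source E (1 : G))]
  have h3 := HasFDerivAt.comp (chartAt E (1 : G) 1) (h2.symm ▸ h1 g) (h1 g⁻¹)
  have : IsTopologicalGroup G := topologicalGroup_of_lieGroup 𝓘(ℝ, E) ∞
  have hc : ContinuousAt (fun y : E => g⁻¹ * (chartAt E (1 : G)).symm y * g⁻¹⁻¹)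
      (chartAt E (1 : G) 1) :=
    (continuousAt_const.mul ((chartAt E (1 : G)).continuousAt_symm
      (mem_chart_target E (1 : G)))).mul continuousAt_const
  have h4 : (fun y : E => y) =ᶠ[nhds (chartAt E (1 : G) 1)]
      (fun y : E => chartAt E (1 : G) (g * (chartAt E (1 : G)).symm y * g⁻¹)) ∘
      fun y : E => chartAt E (1 : G) (g⁻¹ * (chartAt E (1 : G)).symm y * g⁻¹⁻¹) := by
    have h5 : ∀ᶠ y in nhds (chartAt E (1 : G) 1),
        g⁻¹ * (chartAt E (1 : G)).symm y * g⁻¹⁻¹ ∈ (chartAt E (1 : G)).source := by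
      refine hc.eventually_mem ((chartAt E (1 : G)).open_source.mem_nhds ?_)
      simp [(chartAt E (1 : G)).left_inv (mem_chart_source E (1 : G))]
    filter_upwards [h5, (chartAt E (1 : G)).open_target.mem_nhds (mem_chart_target E (1 : G))]
      with y hy hy'
    simp only [Function.comp_apply]
    rw [(chartAt E (1 : G)).left_inv hy]
    simp [mul_assoc, (chartAt E (1 : G)).right_inv hy']
  have h6 := (h3.congr_of_eventuallyEq h4).unique (hasFDerivAt_id _)
  exact DFunLike.congr_fun h6 v

theorem comp_adjointModel_injective (g : G) :
    Function.Injective fun lam : E →L[ℝ] ℝ => lam.comp (adjointModel E g) := by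
  intro lam mu h
  ext v
  have := DFunLike.congr_fun h (adjointModel E g⁻¹ v)
  change lam (adjointModel E g (adjointModel E g⁻¹ v)) =
    mu (adjointModel E g (adjointModel E g⁻¹ v)) at this
  rwa [adjointModel_apply_adjointModel_inv] at this

end LieGroupCharts

/-! ### Control and velocity of a curve in charts. -/

section CurveControl

variable {E : Type*} [NormedAddCommGroup E] [NormedSpace ℝ E]
  {G : Type*} [TopologicalSpace G] [ChartedSpace E G] [Group G] [LieGroup 𝓘(ℝ, E) ∞ G]

theorem hasDerivWithinAt_curveControl {I : Set ℝ} {γ : ℝ → G} {t : ℝ}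
    (hγ : MDifferentiableWithinAt 𝓘(ℝ, ℝ) 𝓘(ℝ, E) γ I t) :
    HasDerivWithinAt (fun s => chartAt E (1 : G) ((γ t)⁻¹ * γ s))
      (controlModel E I γ t) I t := by
  have hd : MDifferentiableAt 𝓘(ℝ, E) 𝓘(ℝ, E) (fun x : G => (γ t)⁻¹ * x) (γ t) :=
    ContMDiffAt.mdifferentiableAt (n := ∞) (contMDiffAt_const.mul contMDiffAt_id) (by simp)
  have h1 := (hd.hasMFDerivAt.comp_hasMFDerivWithinAt t hγ.hasMFDerivWithinAt).2
  have h2 : (γ t)⁻¹ * γ t = 1 := by simp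
  simp only [writtenInExtChartAt, Function.comp_apply, h2] at h1
  simp [Function.comp_def] at h1
  -- Naming the differential `L` gives it a type over the model space instead of dependent tangent
  -- spaces.
  obtain ⟨L, hL, hd⟩ : ∃ L : ℝ →L[ℝ] E, L 1 = controlModel E I γ t ∧
      HasFDerivWithinAt (fun s => chartAt E (1 : G) ((γ t)⁻¹ * γ s)) L I t := ⟨_, rfl, h1⟩
  rw [← hL]
  exact hd.hasDerivWithinAt

/-- Write `γ s = γ t * ((γ t)⁻¹ * γ s)`; the second factor has the control as its derivative at `s =
t`. -/
theorem MDifferentiableWithinAt.hasDerivWithinAt_chart {I : Set ℝ} {γ : ℝ → G} {t : ℝ}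
    (hγ : MDifferentiableWithinAt 𝓘(ℝ, ℝ) 𝓘(ℝ, E) γ I t)
    {c : G} (hc : γ t ∈ (chartAt E c).source) :
    HasDerivWithinAt (fun s => chartAt E c (γ s))
      (leftTranslationDeriv E c (chartAt E c (γ t)) (controlModel E I γ t)) I t := by
  have : IsTopologicalGroup G := topologicalGroup_of_lieGroup 𝓘(ℝ, E) ∞
  have h1 := hasDerivWithinAt_curveControl hγ
  have h2 := (differentiableAt_chart_mul (E := E) hc).hasFDerivAt
  have h3 : chartAt E (1 : G) 1 = chartAt E (1 : G) ((γ t)⁻¹ * γ t) := by simp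
  rw [h3] at h2
  have h4 := h2.comp_hasDerivWithinAt t h1
  rw [← h3] at h4
  have h5 : ∀ᶠ s in nhdsWithin t I, (γ t)⁻¹ * γ s ∈ (chartAt E (1 : G)).source := by
    refine (continuousWithinAt_const.mul hγ.continuousWithinAt).eventually_mem
      ((chartAt E (1 : G)).open_source.mem_nhds ?_)
    simp
  refine h4.congr_of_eventuallyEq ?_ ?_
  · filter_upwards [h5] with s hs
    simp [(chartAt E (1 : G)).left_inv hs, (chartAt E c).left_inv hc]
  · simp [(chartAt E (1 : G)).left_inv (mem_chart_source E (1 : G)), (chartAt E c).left_inv hc]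

/-- Left translation by `g⁻¹`, read in charts, supplies a left inverse of the differential. -/
theorem leftTranslationDeriv_injective {c g : G} (hg : g ∈ (chartAt E c).source) :
    Function.Injective (leftTranslationDeriv E c (chartAt E c g)) := by
  have : IsTopologicalGroup G := topologicalGroup_of_lieGroup 𝓘(ℝ, E) ∞
  have h1 := (differentiableAt_chart_mul (E := E) hg).hasFDerivAt
  have h2 : ContMDiffAt 𝓘(ℝ, E) 𝓘(ℝ, E) ∞
      (fun x : E => chartAt E (1 : G) (g⁻¹ * (chartAt E c).symm x)) (chartAt E c g) :=
    ContMDiffAt.comp _ (contMDiffAt_chartAt 1 (by simp [(chartAt E c).left_inv hg]))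
      (contMDiffAt_const.mul (contMDiffAt_chartAt_symm c ((chartAt E c).map_source hg)))
  have h3 := ((contMDiffAt_iff_contDiffAt.1 h2).differentiableAt (by simp)).hasFDerivAt
  have h4 : chartAt E c g = chartAt E c
      ((chartAt E c).symm (chartAt E c g) * (chartAt E (1 : G)).symm (chartAt E (1 : G) 1)) := by
    simp [(chartAt E (1 : G)).left_inv (mem_chart_source E (1 : G)), (chartAt E c).left_inv hg]
  have h3' : HasFDerivAt (fun x : E => chartAt E (1 : G) (g⁻¹ * (chartAt E c).symm x))
      (fderiv ℝ (fun x : E => chartAt E (1 : G) (g⁻¹ * (chartAt E c).symm x)) (chartAt E c g))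
      (chartAt E c ((chartAt E c).symm (chartAt E c g) *
        (chartAt E (1 : G)).symm (chartAt E (1 : G) 1))) := by
    rw [← h4]
    exact h3
  have h5 := h3'.comp (chartAt E (1 : G) 1) h1
  have h6 : ∀ᶠ y in nhds (chartAt E (1 : G) 1),
      g * (chartAt E (1 : G)).symm y ∈ (chartAt E c).source := by
    refine ContinuousAt.eventually_mem (continuousAt_const.mul
      ((chartAt E (1 : G)).continuousAt_symm (mem_chart_target E (1 : G))))
      ((chartAt E c).open_source.mem_nhds ?_)
    simpa [(chartAt E (1 : G)).left_inv (mem_chart_source E (1 : G))] using hg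
  have h7 := (h5.congr_of_eventuallyEq (f₁ := fun y => y) (by
    filter_upwards [h6, (chartAt E (1 : G)).open_target.mem_nhds (mem_chart_target E (1 : G))]
      with y hy hy'
    simp [(chartAt E c).left_inv hg, (chartAt E c).left_inv hy,
      (chartAt E (1 : G)).right_inv hy'])).unique (hasFDerivAt_id _)
  intro v w hvw
  have hv := DFunLike.congr_fun h7 v
  have hw := DFunLike.congr_fun h7 w
  simp only [ContinuousLinearMap.comp_apply, ContinuousLinearMap.id_apply] at hv hw
  rw [← hv, ← hw]
  exact congrArg _ hvw

theorem mdifferentiableWithinAt_of_differentiableWithinAt_chart {I : Set ℝ} {γ : ℝ → G} {t : ℝ}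
    {c : G} (hc : γ t ∈ (chartAt E c).source) (hγ : ContinuousWithinAt γ I t)
    (hd : DifferentiableWithinAt ℝ (fun s => chartAt E c (γ s)) I t) :
    MDifferentiableWithinAt 𝓘(ℝ, ℝ) 𝓘(ℝ, E) γ I t := by
  have h1 : IsManifold 𝓘(ℝ, E) 1 G := IsManifold.of_le (n := ∞) (by exact_mod_cast le_top)
  rw [mdifferentiableWithinAt_iff_of_mem_source (mem_chart_source ℝ t) hc]
  refine ⟨hγ, ?_⟩
  simp only [mfld_simps]
  exact hd

end CurveControl

/-! ### Normal curves as integral curves of a locally Lipschitz field. -/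

section NormalCurves

variable {E : Type*} [NormedAddCommGroup E] [NormedSpace ℝ E]
  {G : Type*} [TopologicalSpace G] [ChartedSpace E G] [Group G]

/-- The vector field `g ↦ dL_g (Φ (lam ∘ Ad_g))` in the chart at `c`; its integral curves are the
normal curves with covector `lam` when `Φ` is the inverse of the subdifferential of the energy. -/
noncomputable def normalField (c : G) (Φ : (E →L[ℝ] ℝ) → E) (lam : E →L[ℝ] ℝ) (x : E) : E :=
  leftTranslationDeriv E c x (Φ (lam.comp (adjointModel E ((chartAt E c).symm x))))

variable [LieGroup 𝓘(ℝ, E) ∞ G]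

/-- The field applies a `C¹` family of linear maps to a vector depending on `x` in a locally
Lipschitz way, and evaluation is smooth. As `Φ` is only Lipschitz, the field need not be `C¹`. -/
theorem exists_lipschitzOnWith_normalField {Φ : (E →L[ℝ] ℝ) → E} {K : NNReal}
    (hΦ : LipschitzWith K Φ) (lam : E →L[ℝ] ℝ) {c g : G} (hg : g ∈ (chartAt E c).source) :
    ∃ K', ∃ s ∈ nhds (chartAt E c g), LipschitzOnWith K' (normalField c Φ lam) s := by
  obtain ⟨K₁, s₁, hs₁, h₁⟩ := (contDiffAt_leftTranslationDeriv hg).exists_lipschitzOnWith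
  obtain ⟨K₂, s₂, hs₂, h₂⟩ :=
    ((contDiffAt_const (c := lam)).clm_comp (contDiffAt_adjointModel hg)).exists_lipschitzOnWith
  have h₃ := (h₁.mono inter_subset_left).prodMk
    ((hΦ.comp_lipschitzOnWith h₂).mono (inter_subset_right (s := s₁)))
  set P : E → (E →L[ℝ] E) × E := fun x => (leftTranslationDeriv E c x,
    Φ (lam.comp (adjointModel E ((chartAt E c).symm x)))) with hP
  have hPc : ContinuousAt P (chartAt E c g) :=
    h₃.continuousOn.continuousAt (Filter.inter_mem hs₁ hs₂)
  obtain ⟨K₄, s₄, hs₄, h₄⟩ := (isBoundedBilinearMap_apply (𝕜 := ℝ) (E := E)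
    (F := E)).contDiff.contDiffAt.exists_lipschitzOnWith (x := P (chartAt E c g))
  refine ⟨K₄ * max K₁ (K * K₂), (s₁ ∩ s₂) ∩ P ⁻¹' s₄, Filter.inter_mem (Filter.inter_mem hs₁ hs₂)
    (hPc.preimage_mem_nhds hs₄), ?_⟩
  exact h₄.comp (h₃.mono inter_subset_left) fun x hx => hx.2

theorem continuousAt_normalField {Φ : (E →L[ℝ] ℝ) → E} {K : NNReal}
    (hΦ : LipschitzWith K Φ) (lam : E →L[ℝ] ℝ) {c g : G} (hg : g ∈ (chartAt E c).source) :
    ContinuousAt (normalField c Φ lam) (chartAt E c g) := by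
  obtain ⟨K', s, hs, h⟩ := exists_lipschitzOnWith_normalField hΦ lam hg
  exact h.continuousOn.continuousAt hs

/-- The right-hand side is continuous along the curve, so the ODE, known almost everywhere, holds at
every time. -/
theorem hasDerivWithinAt_chart_of_ae_control_eq [FiniteDimensional ℝ E] {I : Set ℝ}
    (hI : I.OrdConnected) (hI' : I.Nontrivial) {γ : ℝ → G}
    (hγ : IsAbsolutelyContinuousCurve E I γ) {Φ : (E →L[ℝ] ℝ) → E} {K : NNReal}
    (hΦ : LipschitzWith K Φ) {lam : E →L[ℝ] ℝ}
    (hu : ∀ᵐ t ∂(volume.restrict I), controlModel E I γ t = Φ (lam.comp (adjointModel E (γ t))))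
    {t : ℝ} (ht : t ∈ I) {c : G} (hc : γ t ∈ (chartAt E c).source) :
    HasDerivWithinAt (fun s => chartAt E c (γ s)) (normalField c Φ lam (chartAt E c (γ t))) I t := by
  obtain ⟨a, b, hab, htab, hsub, hmaps, hnhds⟩ := OrdConnected.exists_Icc_mem_nhdsWithin hI hI' ht
    ((hγ.1 t ht).preimage_mem_nhdsWithin ((chartAt E c).open_source.mem_nhds hc))
  have hcont : ContinuousOn (fun s => chartAt E c (γ s)) (Icc a b) :=
    (chartAt E c).continuousOn.comp (hγ.1.mono hsub) hmaps
  refine (AbsolutelyContinuousOnInterval.hasDerivWithinAt_of_ae hab.le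
    (g := fun s => normalField c Φ lam (chartAt E c (γ s)))
    (hγ.2 c a b hab.le hsub hmaps) ?_ ?_ t htab).mono_of_mem_nhdsWithin hnhds
  · exact fun s hs => ContinuousAt.comp_continuousWithinAt
      (f := fun s => chartAt E c (γ s)) (continuousAt_normalField hΦ lam (hmaps hs)) (hcont s hs)
  · rw [ae_restrict_iff' hI.measurableSet] at hu
    filter_upwards [hu] with s hs hsab v hv
    have hs' := Ioo_subset_Icc_self hsab
    have hIs : I ∈ nhds s := Filter.mem_of_superset (Icc_mem_nhds hsab.1 hsab.2) hsub
    have hd := (mdifferentiableWithinAt_of_differentiableWithinAt_chart (hmaps hs')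
      (hγ.1 s (hsub hs')) hv.differentiableAt.differentiableWithinAt).hasDerivWithinAt_chart
      (hmaps hs')
    rw [hs (hsub hs')] at hd
    rw [(hd.hasDerivAt hIs).unique hv |>.symm, normalField, (chartAt E c).left_inv (hmaps hs')]

theorem mdifferentiableWithinAt_of_ae_control_eq [FiniteDimensional ℝ E] {I : Set ℝ}
    (hI : I.OrdConnected) (hI' : I.Nontrivial) {γ : ℝ → G}
    (hγ : IsAbsolutelyContinuousCurve E I γ) {Φ : (E →L[ℝ] ℝ) → E} {K : NNReal}
    (hΦ : LipschitzWith K Φ) {lam : E →L[ℝ] ℝ}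
    (hu : ∀ᵐ t ∂(volume.restrict I), controlModel E I γ t = Φ (lam.comp (adjointModel E (γ t))))
    {t : ℝ} (ht : t ∈ I) : MDifferentiableWithinAt 𝓘(ℝ, ℝ) 𝓘(ℝ, E) γ I t :=
  mdifferentiableWithinAt_of_differentiableWithinAt_chart (mem_chart_source E (γ t)) (hγ.1 t ht)
    (hasDerivWithinAt_chart_of_ae_control_eq hI hI' hγ hΦ hu ht
      (mem_chart_source E (γ t))).differentiableWithinAt

/-- The chart derivative is the translated control and also the field; the differential of left
translation is injective, so the vectors agree at every time. -/
theorem control_eq_of_ae_control_eq [FiniteDimensional ℝ E] {I : Set ℝ}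
    (hI : I.OrdConnected) (hI' : I.Nontrivial) {γ : ℝ → G}
    (hγ : IsAbsolutelyContinuousCurve E I γ) {Φ : (E →L[ℝ] ℝ) → E} {K : NNReal}
    (hΦ : LipschitzWith K Φ) {lam : E →L[ℝ] ℝ}
    (hu : ∀ᵐ t ∂(volume.restrict I), controlModel E I γ t = Φ (lam.comp (adjointModel E (γ t))))
    {t : ℝ} (ht : t ∈ I) : controlModel E I γ t = Φ (lam.comp (adjointModel E (γ t))) := by
  have hU : UniqueDiffWithinAt ℝ I t := by
    obtain ⟨a, b, hab, htab, hsub, -, -⟩ :=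
      OrdConnected.exists_Icc_mem_nhdsWithin hI hI' ht Filter.univ_mem
    exact (uniqueDiffOn_Icc hab t htab).mono hsub
  have h1 := hasDerivWithinAt_chart_of_ae_control_eq hI hI' hγ hΦ hu ht (mem_chart_source E (γ t))
  have h2 := (mdifferentiableWithinAt_of_ae_control_eq hI hI' hγ hΦ hu ht).hasDerivWithinAt_chart
    (mem_chart_source E (γ t))
  rw [normalField, (chartAt E (γ t)).left_inv (mem_chart_source E (γ t))] at h1
  exact leftTranslationDeriv_injective (mem_chart_source E (γ t)) (hU.eq_deriv _ h2 h1)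

theorem t2Space_of_lieGroup (E : Type*) [NormedAddCommGroup E] [NormedSpace ℝ E] (G : Type*)
    [TopologicalSpace G] [ChartedSpace E G] [Group G] [LieGroup 𝓘(ℝ, E) ∞ G] : T2Space G := by
  have : IsTopologicalGroup G := topologicalGroup_of_lieGroup 𝓘(ℝ, E) ∞
  have : T1Space G := ChartedSpace.t1Space E G
  infer_instance

/-- Two normal curves with the same covector that meet coincide. -/
theorem eqOn_of_ae_control_eq [FiniteDimensional ℝ E] {I : Set ℝ}
    (hI : I.OrdConnected) (hI' : I.Nontrivial) {γ₁ γ₂ : ℝ → G}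
    (hγ₁ : IsAbsolutelyContinuousCurve E I γ₁) (hγ₂ : IsAbsolutelyContinuousCurve E I γ₂)
    {Φ : (E →L[ℝ] ℝ) → E} {K : NNReal} (hΦ : LipschitzWith K Φ) {lam : E →L[ℝ] ℝ}
    (hu₁ : ∀ᵐ t ∂(volume.restrict I),
      controlModel E I γ₁ t = Φ (lam.comp (adjointModel E (γ₁ t))))
    (hu₂ : ∀ᵐ t ∂(volume.restrict I),
      controlModel E I γ₂ t = Φ (lam.comp (adjointModel E (γ₂ t))))
    {t : ℝ} (ht : t ∈ I) (h : γ₁ t = γ₂ t) : EqOn γ₁ γ₂ I := by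
  have : T2Space G := t2Space_of_lieGroup E G
  have : PreconnectedSpace I := Subtype.preconnectedSpace hI.isPreconnected
  -- The coincidence set is clopen in the connected interval: closed because `G` is Hausdorff, open
  -- by local ODE uniqueness.
  have hclosed : IsClosed {s : I | γ₁ s = γ₂ s} :=
    isClosed_eq hγ₁.1.domRestrict hγ₂.1.domRestrict
  have hopen : IsOpen {s : I | γ₁ s = γ₂ s} := by
    rw [isOpen_iff_mem_nhds]
    rintro ⟨s, hs⟩ (hss : γ₁ s = γ₂ s)
    obtain ⟨K', u, hu, hX⟩ :=
      exists_lipschitzOnWith_normalField hΦ lam (mem_chart_source E (γ₁ s))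
    have hev : ∀ γ : ℝ → G, γ s = γ₁ s → IsAbsolutelyContinuousCurve E I γ →
        (∀ᵐ t ∂(volume.restrict I), controlModel E I γ t = Φ (lam.comp (adjointModel E (γ t)))) →
        ∀ᶠ r in nhdsWithin s I, γ r ∈ (chartAt E (γ₁ s)).source ∧
          HasDerivWithinAt (fun s' => chartAt E (γ₁ s) (γ s'))
            (normalField (γ₁ s) Φ lam (chartAt E (γ₁ s) (γ r))) I r := fun γ hγs hγ hγu => by
      filter_upwards [self_mem_nhdsWithin, (hγ.1 s hs).preimage_mem_nhdsWithin
        ((chartAt E (γ₁ s)).open_source.mem_nhds (hγs ▸ mem_chart_source E (γ s)))] with r hr hr'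
      exact ⟨hr', hasDerivWithinAt_chart_of_ae_control_eq hI hI' hγ hΦ hγu hr hr'⟩
    have h1 := hev γ₁ rfl hγ₁ hu₁
    have h2 := hev γ₂ hss.symm hγ₂ hu₂
    have h3 := eventuallyEq_nhdsWithin_of_hasDerivWithinAt hI hI' hX hs hu (h1.mono fun _ h => h.2)
      (h2.mono fun _ h => h.2) (congrArg _ hss)
    rw [mem_nhds_subtype_iff_nhdsWithin]
    filter_upwards [h1, h2, h3, self_mem_nhdsWithin] with r hr1 hr2 hr3 hr
    exact ⟨⟨r, hr⟩, (chartAt E (γ₁ s)).injOn hr1.1 hr2.1 hr3, rfl⟩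
  have huniv := IsClopen.eq_univ ⟨hclosed, hopen⟩ ⟨⟨t, ht⟩, h⟩
  exact fun s hs => (huniv ▸ mem_univ (⟨s, hs⟩ : I) : (⟨s, hs⟩ : I) ∈ {s : I | γ₁ s = γ₂ s})

end NormalCurves

/-! ### Recovering the covector, and the main theorem. -/

section Uniqueness

variable {E : Type*} [NormedAddCommGroup E] [NormedSpace ℝ E]
  {G : Type*} [TopologicalSpace G] [ChartedSpace E G] [Group G]

theorem IsNormalCurve.exists_covector {p : Seminorm ℝ (GroupLieAlgebra 𝓘(ℝ, E) G)} {I : Set ℝ}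
    {γ : ℝ → G} (hγ : IsNormalCurve p I γ) {q : Seminorm ℝ E} (hpq : ∀ v : E, p v = q v)
    {Φ : (E →L[ℝ] ℝ) → E} (hΦ : ∀ η u, η ∈ subdifferential (normEnergy q) u ↔ u = Φ η) :
    ∃ lam : E →L[ℝ] ℝ, ∀ᵐ t ∂(volume.restrict I),
      controlModel E I γ t = Φ (lam.comp (adjointModel E (γ t))) := by
  obtain ⟨-, -, lam, hlam⟩ := hγ
  refine ⟨lam, hlam.mono fun t ht => (hΦ _ _).1 fun v => ?_⟩
  have h := ht v
  simp only [normEnergy] at h ⊢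
  rw [← hpq, ← hpq]
  exact h

variable [LieGroup 𝓘(ℝ, E) ∞ G]

/-- Two normal curves with the same position and the same control at some time coincide if the
energy is differentiable at that control. -/
theorem IsNormalCurve.eqOn_of_control_eq [FiniteDimensional ℝ E]
    {p : Seminorm ℝ (GroupLieAlgebra 𝓘(ℝ, E) G)} {I : Set ℝ}
    (hI : I.OrdConnected) (hI' : I.Nontrivial) {γ₁ γ₂ : ℝ → G}
    (hγ₁ : IsNormalCurve p I γ₁) (hγ₂ : IsNormalCurve p I γ₂) {q : Seminorm ℝ E}
    (hpq : ∀ v : E, p v = q v) {Φ : (E →L[ℝ] ℝ) → E} {K : NNReal} (hΦK : LipschitzWith K Φ)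
    (hΦ : ∀ η u, η ∈ subdifferential (normEnergy q) u ↔ u = Φ η) {t : ℝ} (ht : t ∈ I)
    (h : γ₁ t = γ₂ t) (hu : controlModel E I γ₁ t = controlModel E I γ₂ t)
    (hd : DifferentiableAt ℝ (normEnergy q) (controlModel E I γ₁ t)) : EqOn γ₁ γ₂ I := by
  obtain ⟨lam₁, h₁⟩ := hγ₁.exists_covector hpq hΦ
  obtain ⟨lam₂, h₂⟩ := hγ₂.exists_covector hpq hΦ
  have e₁ := (hΦ _ _).2 (control_eq_of_ae_control_eq hI hI' hγ₁.1 hΦK h₁ ht)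
  have e₂ := (hΦ _ _).2 (control_eq_of_ae_control_eq hI hI' hγ₂.1 hΦK h₂ ht)
  rw [← hu, ← h] at e₂
  obtain rfl : lam₁ = lam₂ := comp_adjointModel_injective (γ₁ t)
    ((eq_fderiv_of_mem_subdifferential hd e₁).trans (eq_fderiv_of_mem_subdifferential hd e₂).symm)
  exact eqOn_of_ae_control_eq hI hI' hγ₁.1 hγ₂.1 hΦK h₁ h₂ ht h

/-- The control is the derivative of `(γ t)⁻¹ * γ s` in the chart at `1`, so it depends only on the
germ of the curve. -/
theorem controlModel_eq_of_eventuallyEq {I : Set ℝ} {γ₁ γ₂ : ℝ → G} {t : ℝ}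
    (hI : UniqueDiffWithinAt ℝ I t)
    (h₁ : MDifferentiableWithinAt 𝓘(ℝ, ℝ) 𝓘(ℝ, E) γ₁ I t)
    (h₂ : MDifferentiableWithinAt 𝓘(ℝ, ℝ) 𝓘(ℝ, E) γ₂ I t)
    (h : γ₁ =ᶠ[nhdsWithin t I] γ₂) (ht : γ₁ t = γ₂ t) :
    controlModel E I γ₁ t = controlModel E I γ₂ t := by
  refine hI.eq_deriv _ (hasDerivWithinAt_curveControl h₁)
    ((hasDerivWithinAt_curveControl h₂).congr_of_eventuallyEq ?_ (by simp))
  filter_upwards [h] with s hs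
  rw [hs, ht]

end Uniqueness

theorem mainTheorem6 {E : Type*} [NormedAddCommGroup E] [NormedSpace ℝ E] [FiniteDimensional ℝ E]
    {G : Type*} [TopologicalSpace G] [ChartedSpace E G] [Group G] [LieGroup 𝓘(ℝ, E) ∞ G]
    (p : Seminorm ℝ (GroupLieAlgebra 𝓘(ℝ, E) G))
    (hp : ∀ v, p v = 0 → v = 0)
    (hconv : IsStronglyConvexNorm p) :
    (∀ γ : ℝ → G, IsNormalCurve p (Icc 0 1) γ →
      MDifferentiableOn 𝓘(ℝ, ℝ) 𝓘(ℝ, E) γ (Icc 0 1)) ∧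
    (∀ γ₁ γ₂ : ℝ → G, IsNormalCurve p (Icc 0 1) γ₁ → IsNormalCurve p (Icc 0 1) γ₂ →
      (∃ t ∈ Icc (0 : ℝ) 1,
        γ₁ t = γ₂ t ∧
        (⟨γ₁ t, velocity E (Icc 0 1) γ₁ t⟩ : TangentBundle 𝓘(ℝ, E) G) =
          ⟨γ₂ t, velocity E (Icc 0 1) γ₂ t⟩ ∧
        DifferentiableAt ℝ p (curveControl E (Icc 0 1) γ₁ t)) →
      EqOn γ₁ γ₂ (Icc 0 1)) ∧
    ((∀ v, v ≠ 0 → DifferentiableAt ℝ p v) → ¬ HasBranchingOfNormalCurves p) := by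
  -- The Lie algebra is `E` by definition; `q` is `p` viewed on the normed space `E`, where the
  -- convex analysis applies.
  obtain ⟨q, hpq⟩ : ∃ q : Seminorm ℝ E, ∀ v : E, p v = q v := ⟨p, fun _ => rfl⟩
  obtain ⟨Φ, K, hΦK, hΦ⟩ : ∃ (Φ : (E →L[ℝ] ℝ) → E) (K : NNReal), LipschitzWith K Φ ∧
      ∀ η u, η ∈ subdifferential (normEnergy q) u ↔ u = Φ η := by
    refine exists_lipschitzWith_inverse_subdifferential (fun v hv => hp v ((hpq v).trans hv)) ?_
    have : normEnergy q = normEnergy p := funext fun v => by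
      simp only [normEnergy]
      rw [← hpq]
    rw [IsStronglyConvexNorm, this]
    exact hconv
  have hdiff : ∀ v : E, DifferentiableAt ℝ p v → DifferentiableAt ℝ (normEnergy q) v :=
    fun v hv => differentiableAt_normEnergy (funext hpq ▸ hv)
  have h01 : (Icc (0 : ℝ) 1).Nontrivial := ⟨0, by simp, 1, by simp, zero_ne_one⟩
  refine ⟨fun γ hγ t ht => ?_, ?_, ?_⟩
  · obtain ⟨lam, hlam⟩ := hγ.exists_covector hpq hΦ
    exact mdifferentiableWithinAt_of_ae_control_eq ordConnected_Icc h01 hγ.1 hΦK hlam ht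
  · rintro γ₁ γ₂ hγ₁ hγ₂ ⟨t, ht, h, hv, hd⟩
    refine hγ₁.eqOn_of_control_eq ordConnected_Icc h01 hγ₂ hpq hΦK hΦ ht h ?_ (hdiff _ hd)
    -- The control is a function of the point of the tangent bundle, so no identification of the two
    -- fibres is needed.
    exact congrArg (fun w : TangentBundle 𝓘(ℝ, E) G =>
      (mfderiv 𝓘(ℝ, E) 𝓘(ℝ, E) (fun x : G => w.1⁻¹ * x) w.1 w.2 : E)) hv
  · rintro hsmooth ⟨I, J, γ₁, γ₂, hI, hJ, hJ', hJI, hγ₁, hγ₂, heq, hne⟩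
    have hI' : I.Nontrivial := hJ'.mono hJI
    obtain ⟨a, ha, b, hb, hab⟩ := hJ'.exists_lt
    -- An interior time of `J` is chosen so that equality on `J` forces equality of the controls
    -- relative to `I`.
    obtain ⟨t, hat, htb⟩ := exists_between hab
    have hJt : J ∈ nhds t := Filter.mem_of_superset (Icc_mem_nhds hat htb) (hJ.out ha hb)
    have htI : t ∈ I := hJI (mem_of_mem_nhds hJt)
    have hmd : ∀ γ : ℝ → G, IsNormalCurve p I γ →
        MDifferentiableWithinAt 𝓘(ℝ, ℝ) 𝓘(ℝ, E) γ I t := fun γ hγ => by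
      obtain ⟨lam, hlam⟩ := hγ.exists_covector hpq hΦ
      exact mdifferentiableWithinAt_of_ae_control_eq hI hI' hγ.1 hΦK hlam htI
    refine hne (hγ₁.eqOn_of_control_eq hI hI' hγ₂ hpq hΦK hΦ htI (heq (mem_of_mem_nhds hJt)) ?_ ?_)
    · exact controlModel_eq_of_eventuallyEq
        (uniqueDiffWithinAt_of_mem_nhds (Filter.mem_of_superset hJt hJI)) (hmd γ₁ hγ₁)
        (hmd γ₂ hγ₂) (mem_nhdsWithin_of_mem_nhds (Filter.mem_of_superset hJt heq))
        (heq (mem_of_mem_nhds hJt))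
    · by_cases h0 : controlModel E I γ₁ t = 0
      · rw [h0]
        exact differentiableAt_normEnergy_zero q
      · exact hdiff _ (hsmooth _ h0)
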